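/- Let $R$ be a ring with identity. For an $R$-module $M$ with endomorphism ring $S=\operatorname{End}_R(M)$, acting on the left, call $M$ endo-noetherian (endo-artinian) if $M$ is noetherian (artinian) as an $S$-module, and let the endosocle of $M$ be the socle of the $S$-module $M$. A module is finitely cogenerated if every family of submodules with zero intersection has a finite subfamily with zero intersection. A family $(N_j)_{j\in J}$ of $R$-modules is right semi-T-nilpotent if, for every sequence $(j_n)_{n\ge 1}$ of pairwise distinct indices in $J$, all non-isomorphisms $f_n\in\operatorname{Hom}_R(N_{j_n},N_{j_{n+1}})$ $(n\ge1)$ and every finitely generated submodule $X\subseteq N_{j_1}$, there is $n_0$ with $f_{n_0}\cdots f_2f_1(X)=0$. It is left semi-T-nilpotent if, for every sequence $(j_n)_{n\ge1}$ of pairwise distinct indices in $J$, all non-isomorphisms $f_n\in\operatorname{Hom}_R(N_{j_{n+1}},N_{j_n})$ and every submodule $X\subseteq N_{j_1}$ with $N_{j_1}/X$ finitely cogenerated, there is $n_0$ with $\operatorname{Im}(f_1f_2\cdots f_{n_0})\subseteq X$. It is right T-nilpotent if the first condition holds for arbitrary sequences of indices in $J$, repetitions allowed. Theorem H. Let $(M_i)_{i\in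 I}$ be a family of indecomposable (in particular nonzero) $R$-modules, and let $(M_t)_{t\in T}$, $T\subseteq I$, be a transversal of the isomorphism classes of the $M_i$, that is, each $M_i$ is isomorphic to $M_t$ for exactly one $t\in T$. (I) If all $M_i$ have local endomorphism rings, then the following are equivalent: (1) $\bigoplus_{i\in I}M_i$ is endo-noetherian and $(M_t)_{t\in T}$ is right semi-T-nilpotent; (2) $T$ is finite and each $M_t$, $t\in T$, is endo-noetherian. (II) The following are equivalent: (1) $\bigoplus_{i\in I}M_i$ is endo-artinian and $(M_t)_{t\in T}$ is left semi-T-nilpotent; (2) $T$ is finite and each $M_t$, $t\in T$, is endo-artinian. (III) Suppose that $(M_t)_{t\in T}$ is left semi-T-nilpotent and right T-nilpotent, and that for every subset $T'\subseteq T$ with $T\setminus T'$ finite, the endosocle of $\bigoplus_{t\in T'}M_t$ is finitely generated as a module over $\operatorname{End}_R\bigl(\bigoplus_{t\in T'}M_t\bigr)$. Then $T$ is finite. -/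

import Mathlib

open scoped DirectSum

namespace EndoSum

universe u v w

/-- A module is indecomposable if it is nonzero and is not the direct sum of two nonzero
submodules. -/
def IsIndecomposable (R : Type u) [Ring R] (N : Type v) [AddCommGroup N] [Module R N] : Prop :=
  Nontrivial N ∧ ∀ A B : Submodule R N, IsCompl A B → A = ⊥ ∨ B = ⊥

/-- A module is finitely cogenerated if every family of submodules with zero intersection has a
finite subfamily with zero intersection. -/
def IsFinitelyCogenerated (R : Type u) [Ring R] (N : Type v) [AddCommGroup N] [Module R N] :
    Prop :=
  ∀ F : Set (Submodule R N), sInf F = ⊥ → ∃ G : Set (Submodule R N), G ⊆ F ∧ G.Finite ∧ sInf G = ⊥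

/-- The socle of a module: the sum of its simple submodules. -/
def socle (S : Type u) [Ring S] (N : Type v) [AddCommGroup N] [Module S N] : Submodule S N :=
  sSup {U : Submodule S N | IsSimpleModule S U}

/-- The endosocle of an `R`-module: its socle as a module over its endomorphism ring. -/
def endosocle (R : Type u) [Ring R] (N : Type v) [AddCommGroup N] [Module R N] :
    Submodule (Module.End R N) N :=
  socle (Module.End R N) N

/-- A module is endo-noetherian if it is noetherian over its endomorphism ring. -/
def IsEndoNoetherian (R : Type u) [Ring R] (N : Type v) [AddCommGroup N] [Module R N] : Prop :=
  IsNoetherian (Module.End R N) N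

/-- A module is endo-artinian if it is artinian over its endomorphism ring. -/
def IsEndoArtinian (R : Type u) [Ring R] (N : Type v) [AddCommGroup N] [Module R N] : Prop :=
  IsArtinian (Module.End R N) N

/-- The composition `f (n - 1) ∘ ⋯ ∘ f 0 : N 0 → N n` of maps `f k : N k → N (k + 1)`. -/
def forwardComp {R : Type u} [Ring R] {N : ℕ → Type w} [∀ n, AddCommGroup (N n)]
    [∀ n, Module R (N n)] (f : ∀ n, N n →ₗ[R] N (n + 1)) : ∀ n, N 0 →ₗ[R] N n
  | 0 => LinearMap.id
  | n + 1 => (f n).comp (forwardComp f n)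

/-- The composition `f 0 ∘ ⋯ ∘ f (n - 1) : N n → N 0` of maps `f k : N (k + 1) → N k`. -/
def backwardComp {R : Type u} [Ring R] {N : ℕ → Type w} [∀ n, AddCommGroup (N n)]
    [∀ n, Module R (N n)] (f : ∀ n, N (n + 1) →ₗ[R] N n) : ∀ n, N n →ₗ[R] N 0
  | 0 => LinearMap.id
  | n + 1 => (backwardComp f n).comp (f n)

section Nilpotence

variable (R : Type u) [Ring R] {ι : Type v} (M : ι → Type w) [∀ i, AddCommGroup (M i)] [∀ i, Module R (M i)]

/-- The right nilpotence condition along one sequence of indices: every sequence of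
non-isomorphisms `M (i 0) → M (i 1) → ⋯` eventually kills every finitely generated submodule
of `M (i 0)`. -/
def RightNilpotentAlong (i : ℕ → ι) : Prop :=
  ∀ f : ∀ n, M (i n) →ₗ[R] M (i (n + 1)), (∀ n, ¬ Function.Bijective (f n)) →
    ∀ X : Submodule R (M (i 0)), X.FG →
      ∃ n₀, X.map (forwardComp (N := fun n => M (i n)) f n₀) = ⊥

/-- The left nilpotence condition along one sequence of indices: for every sequence of
non-isomorphisms `⋯ → M (i 1) → M (i 0)` and every finitely cogenerated factor module
`M (i 0) / X`, the images of the compositions eventually lie in `X`. -/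
def LeftNilpotentAlong (i : ℕ → ι) : Prop :=
  ∀ f : ∀ n, M (i (n + 1)) →ₗ[R] M (i n), (∀ n, ¬ Function.Bijective (f n)) →
    ∀ X : Submodule R (M (i 0)), IsFinitelyCogenerated R (M (i 0) ⧸ X) →
      ∃ n₀, LinearMap.range (backwardComp (N := fun n => M (i n)) f n₀) ≤ X

/-- Right T-nilpotent families: arbitrary sequences of indices, repetitions allowed. -/
def IsRightTNilpotent : Prop :=
  ∀ i : ℕ → ι, RightNilpotentAlong R M i

/-- Right semi-T-nilpotent families: sequences of pairwise distinct indices. -/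
def IsRightSemiTNilpotent : Prop :=
  ∀ i : ℕ → ι, Function.Injective i → RightNilpotentAlong R M i

/-- Left semi-T-nilpotent families: sequences of pairwise distinct indices. -/
def IsLeftSemiTNilpotent : Prop :=
  ∀ i : ℕ → ι, Function.Injective i → LeftNilpotentAlong R M i

/-- `T` is a transversal of the isomorphism classes of the modules `M i`: each `M i` is
isomorphic to `M t` for exactly one `t ∈ T`. -/
def IsTransversal (T : Set ι) : Prop :=
  ∀ i, ∃! t, t ∈ T ∧ Nonempty (M i ≃ₗ[R] M t)

end Nilpotence

end EndoSum

/-! All three finiteness claims are proved by building, for infinite `T`, a sequence of distinct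
indices that violates nilpotence (`exists_not_rightNilpotentAlong`,
`exists_not_leftNilpotentAlong`).

For (I) and (II), the chain condition stabilises the rejects, respectively traces, taken outside
finite sets of indices. Stability lets a nonzero element always be pushed forward, or a proper
submodule pulled back, to an unused index. Conversely, `componentEmbedding` shows that an
endosubmodule of the sum is determined by its components at the transversal, so chain conditions
pass from finitely many summands to the sum.

For (III), an element killed by all non-isomorphisms generates a simple endosubmodule, so the killed
parts lie in the endosocle, which has finite length. Hence only finitely many indices carry nonzero
killed parts. Removing them and repeating gives cofinite layers, and right T-nilpotence makes every
layer contribute. `pathEnds` measures how much of a layer is reached from deeper ones; it stabilises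
by the finite length. The stable parts are linked by maps from each layer to the previous one, which
contradicts left semi-T-nilpotence. -/

namespace EndoSum

universe u v w

/-! ### Building sequences that violate nilpotence -/

section Sequences

variable {R : Type u} [Ring R] {ι : Type v} {M : ι → Type w} [∀ i, AddCommGroup (M i)]
  [∀ i, Module R (M i)]

theorem exists_seq_rel {σ : Type*} {r : σ → σ → Prop} (step : ∀ a, ∃ b, r a b) (a₀ : σ) :
    ∃ q : ℕ → σ, q 0 = a₀ ∧ ∀ n, r (q n) (q (n + 1)) := by
  choose g hg using step
  exact ⟨fun n => Nat.rec a₀ (fun _ a => g a) n, rfl, fun n => hg _⟩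

/-- States carrying nonzero elements that can be moved by non-isomorphisms give a sequence of
indices along which right nilpotence fails. -/
theorem exists_not_rightNilpotentAlong {σ : Type*} (idx : σ → ι) (x : ∀ a, M (idx a))
    (hx : ∀ a, x a ≠ 0) {r : σ → σ → Prop}
    (step : ∀ a, ∃ b, r a b ∧
      ∃ f : M (idx a) →ₗ[R] M (idx b), ¬ Function.Bijective f ∧ f (x a) = x b) (a₀ : σ) :
    ∃ q : ℕ → σ, q 0 = a₀ ∧ (∀ n, r (q n) (q (n + 1))) ∧
      ¬ RightNilpotentAlong R M fun n => idx (q n) := by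
  obtain ⟨q, hq0, hq⟩ := exists_seq_rel step a₀
  refine ⟨q, hq0, fun n => (hq n).1, fun h => ?_⟩
  choose f hf hfx using fun n => (hq n).2
  obtain ⟨n, hn⟩ := h f hf (Submodule.span R {x (q 0)}) (Submodule.fg_span_singleton _)
  have key : ∀ n, forwardComp (N := fun n => M (idx (q n))) f n (x (q 0)) = x (q n) := by
    intro n
    induction n with
    | zero => rfl
    | succ n ih =>
      change f n (forwardComp (N := fun n => M (idx (q n))) f n (x (q 0))) = _
      rw [ih, hfx]
  have : x (q n) ∈ (Submodule.span R {x (q 0)}).map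
      (forwardComp (N := fun n => M (idx (q n))) f n) :=
    ⟨_, Submodule.mem_span_singleton_self _, key n⟩
  rw [hn] at this
  exact hx _ this

/-- States carrying proper submodules that can be pulled back along non-isomorphisms give a
sequence of indices along which left nilpotence fails. -/
theorem exists_not_leftNilpotentAlong {σ : Type*} (idx : σ → ι)
    (X : ∀ a, Submodule R (M (idx a))) (hX : ∀ a, X a ≠ ⊤) {r : σ → σ → Prop}
    (step : ∀ a, ∃ b, r a b ∧
      ∃ f : M (idx b) →ₗ[R] M (idx a), ¬ Function.Bijective f ∧ (X a).comap f = X b)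
    (a₀ : σ) (ha₀ : IsFinitelyCogenerated R (M (idx a₀) ⧸ X a₀)) :
    ∃ q : ℕ → σ, q 0 = a₀ ∧ (∀ n, r (q n) (q (n + 1))) ∧
      ¬ LeftNilpotentAlong R M fun n => idx (q n) := by
  obtain ⟨q, rfl, hq⟩ := exists_seq_rel step a₀
  refine ⟨q, rfl, fun n => (hq n).1, fun h => ?_⟩
  choose f hf hfx using fun n => (hq n).2
  obtain ⟨n, hn⟩ := h f hf (X (q 0)) ha₀
  have key : ∀ n, (X (q 0)).comap (backwardComp (N := fun n => M (idx (q n))) f n) = X (q n) := by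
    intro n
    induction n with
    | zero => exact Submodule.comap_id _
    | succ n ih =>
      change (X (q 0)).comap ((backwardComp (N := fun n => M (idx (q n))) f n).comp (f n)) = _
      rw [Submodule.comap_comp, ih, hfx]
  apply hX (q n)
  rw [← key n, eq_top_iff]
  exact fun y _ => hn ⟨y, rfl⟩

/-- `F n` holds the forbidden indices, among them all those used before stage `n`. -/
theorem injective_of_recorded {κ : Type*} (i : ℕ → κ) (F : ℕ → Set κ)
    (hi : ∀ n, i n ∉ F n) (hF : ∀ n, F n ⊆ F (n + 1)) (hiF : ∀ n, i n ∈ F (n + 1)) :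
    Function.Injective i := by
  have hmono : Monotone F := monotone_nat_of_le_succ hF
  have hne : ∀ m n, m < n → i m ≠ i n := fun m n hmn e =>
    hi n (e ▸ hmono (Nat.succ_le_of_lt hmn) (hiF m))
  intro m n e
  by_contra hmn
  rcases lt_or_gt_of_ne hmn with h | h
  · exact hne m n h e
  · exact hne n m h e.symm

/-- Take `X` maximal among the submodules avoiding `w`. Every nonzero submodule of the quotient then
contains the class of `w`, so a family with zero intersection already has the zero submodule as a
member. -/
theorem exists_isFinitelyCogenerated_quotient {N : Type w} [AddCommGroup N] [Module R N] {w : N}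
    (hw : w ≠ 0) : ∃ X : Submodule R N, w ∉ X ∧ IsFinitelyCogenerated R (N ⧸ X) := by
  obtain ⟨X, -, hX⟩ := zorn_le_nonempty₀ {X : Submodule R N | w ∉ X}
    (fun c hc hchain Y hY => ⟨sSup c, by
      intro hmem
      obtain ⟨Z, hZ, hwZ⟩ := (Submodule.mem_sSup_of_directed ⟨Y, hY⟩ hchain.directedOn).1 hmem
      exact hc hZ hwZ, fun Z hZ => le_sSup hZ⟩) ⊥ (by simpa using hw)
  refine ⟨X, hX.prop, fun F hF => ?_⟩
  have hne : X.mkQ w ∉ sInf F := by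
    rw [hF, Submodule.mem_bot]
    simpa using hX.prop
  rw [Submodule.mem_sInf] at hne
  push Not at hne
  obtain ⟨Y, hY, hwY⟩ := hne
  refine ⟨{Y}, by simpa using hY, Set.finite_singleton _, ?_⟩
  have hle : X ≤ Y.comap X.mkQ := fun a ha => by
    have : X.mkQ a = 0 := by simpa using ha
    simp only [Submodule.mem_comap, this, Y.zero_mem]
  have : Y.comap X.mkQ ≤ X := hX.le_of_ge (show w ∉ Y.comap X.mkQ from hwY) hle
  rw [sInf_singleton, eq_bot_iff]
  intro z hz
  obtain ⟨a, rfl⟩ := X.mkQ_surjective z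
  simpa using this hz

end Sequences

/-! ### Chain conditions on endosubmodules: parts (I) and (II) -/

section Endo

variable {R : Type u} [Ring R] {ι : Type v} (M : ι → Type w) [∀ i, AddCommGroup (M i)]
  [∀ i, Module R (M i)]

/-- The endosubmodule of `N` of all elements that every homomorphism to `P` maps into the given
endosubmodule of `P`. -/
def rejectInto (N : Type*) [AddCommGroup N] [Module R N] {P : Type*} [AddCommGroup P] [Module R P]
    (V : Submodule (Module.End R P) P) : Submodule (Module.End R N) N where
  carrier := {n | ∀ f : N →ₗ[R] P, f n ∈ V}
  add_mem' ha hb f := by rw [map_add]; exact V.add_mem (ha f) (hb f)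
  zero_mem' f := by rw [map_zero]; exact V.zero_mem
  smul_mem' h _ hn f := hn (f ∘ₗ h)

/-- For `x ∈ V`, every `f ∘ i` is an endomorphism of `P`, so `i x` lies in the reject of `V`;
applying `p` recovers `x`. -/
theorem rejectInto_le_iff {N P : Type*} [AddCommGroup N] [Module R N] [AddCommGroup P] [Module R P]
    (i : P →ₗ[R] N) (p : N →ₗ[R] P) (hpi : ∀ x, p (i x) = x)
    (V W : Submodule (Module.End R P) P) : rejectInto N V ≤ rejectInto N W ↔ V ≤ W := by
  refine ⟨fun h x hx => ?_, fun h n hn f => h (hn f)⟩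
  have : i x ∈ rejectInto N V := fun f => V.smul_mem (f ∘ₗ i) hx
  simpa [hpi] using h this p

/-- The lattice of endosubmodules of a direct summand embeds into that of the module. -/
def rejectIntoEmbedding {N P : Type*} [AddCommGroup N] [Module R N] [AddCommGroup P] [Module R P]
    (i : P →ₗ[R] N) (p : N →ₗ[R] P) (hpi : ∀ x, p (i x) = x) :
    Submodule (Module.End R P) P ↪o Submodule (Module.End R N) N :=
  OrderEmbedding.ofMapLEIff (rejectInto N) (rejectInto_le_iff i p hpi)

theorem IsEndoNoetherian.of_retract {N P : Type*} [AddCommGroup N] [Module R N] [AddCommGroup P]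
    [Module R P] (h : IsEndoNoetherian R N) (i : P →ₗ[R] N) (p : N →ₗ[R] P)
    (hpi : ∀ x, p (i x) = x) : IsEndoNoetherian R P := by
  have : WellFoundedGT (Submodule (Module.End R N) N) := isNoetherian_iff'.1 h
  exact isNoetherian_iff'.2 (rejectIntoEmbedding i p hpi).wellFoundedGT

theorem IsEndoArtinian.of_retract {N P : Type*} [AddCommGroup N] [Module R N] [AddCommGroup P]
    [Module R P] (h : IsEndoArtinian R N) (i : P →ₗ[R] N) (p : N →ₗ[R] P)
    (hpi : ∀ x, p (i x) = x) : IsEndoArtinian R P := by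
  have : WellFoundedLT (Submodule (Module.End R N) N) := h
  exact (rejectIntoEmbedding i p hpi).wellFoundedLT

open Classical in
/-- The component of an endosubmodule of a direct sum. -/
noncomputable def componentSubmodule (U : Submodule (Module.End R (⨁ i, M i)) (⨁ i, M i)) (t : ι) :
    Submodule (Module.End R (M t)) (M t) where
  carrier := {x | DirectSum.lof R ι M t x ∈ U}
  add_mem' ha hb := by
    simp only [Set.mem_ofPred_eq, map_add] at *
    exact U.add_mem ha hb
  zero_mem' := by simp
  smul_mem' e x hx := by
    have := U.smul_mem (DirectSum.lof R ι M t ∘ₗ e ∘ₗ DirectSum.component R ι M t) hx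
    simpa [DirectSum.component.lof_self] using this

variable {M}

theorem IsTransversal.eq_of_linearEquiv {T : Set ι} (hT : IsTransversal R M T) {s t : T}
    (e : M s ≃ₗ[R] M t) : s = t :=
  Subtype.ext ((hT s).unique ⟨s.2, ⟨LinearEquiv.refl R _⟩⟩ ⟨t.2, ⟨e⟩⟩)

theorem IsTransversal.eq_of_bijective {T : Set ι} (hT : IsTransversal R M T) {s t : T}
    (f : M s →ₗ[R] M t) (hf : Function.Bijective f) : s = t :=
  hT.eq_of_linearEquiv (LinearEquiv.ofBijective f hf)

/-- Endomorphisms of the sum carry each coordinate to the isomorphic summand at the transversal and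
back. -/
theorem componentSubmodule_le_iff {T : Set ι} (hT : IsTransversal R M T)
    (U V : Submodule (Module.End R (⨁ i, M i)) (⨁ i, M i)) :
    (∀ t : T, componentSubmodule M U t ≤ componentSubmodule M V t) ↔ U ≤ V := by
  classical
  refine ⟨fun h n hn => ?_, fun h t x hx => h hx⟩
  rw [← DirectSum.sum_support_of n]
  refine V.sum_mem fun i _ => ?_
  obtain ⟨t, ⟨ht, ⟨φ⟩⟩, -⟩ := hT i
  have h1 : DirectSum.lof R ι M t (φ (n i)) ∈ U :=
    U.smul_mem (DirectSum.lof R ι M t ∘ₗ φ.toLinearMap ∘ₗ DirectSum.component R ι M i) hn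
  have h2 : DirectSum.lof R ι M i (φ.symm (DirectSum.component R ι M t
      (DirectSum.lof R ι M t (φ (n i))))) ∈ V := V.smul_mem (DirectSum.lof R ι M i ∘ₗ φ.symm.toLinearMap ∘ₗ
    DirectSum.component R ι M t) (h ⟨t, ht⟩ h1)
  rw [DirectSum.component.lof_self, φ.symm_apply_apply] at h2
  exact h2

/-- Endosubmodules of a direct sum are determined by their components at a transversal. -/
noncomputable def componentEmbedding {T : Set ι} (hT : IsTransversal R M T) :
    Submodule (Module.End R (⨁ i, M i)) (⨁ i, M i) ↪o
      ∀ t : T, Submodule (Module.End R (M t)) (M t) :=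
  OrderEmbedding.ofMapLEIff (fun U t => componentSubmodule M U t) (componentSubmodule_le_iff hT)

theorem isEndoArtinian_directSum {T : Set ι} (hT : IsTransversal R M T) (hfin : T.Finite)
    (h : ∀ t : T, IsEndoArtinian R (M t)) : IsEndoArtinian R (⨁ i, M i) := by
  have := hfin.to_subtype
  have : ∀ t : T, WellFoundedLT (Submodule (Module.End R (M t)) (M t)) := h
  exact (componentEmbedding hT).wellFoundedLT

theorem isEndoNoetherian_directSum {T : Set ι} (hT : IsTransversal R M T) (hfin : T.Finite)
    (h : ∀ t : T, IsEndoNoetherian R (M t)) : IsEndoNoetherian R (⨁ i, M i) := by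
  have := hfin.to_subtype
  have : ∀ t : T, WellFoundedLT (Submodule (Module.End R (M t)) (M t))ᵒᵈ := fun t =>
    have : WellFoundedGT (Submodule (Module.End R (M t)) (M t)) := isNoetherian_iff'.1 (h t)
    inferInstance
  have h1 : WellFoundedLT (∀ t : T, (Submodule (Module.End R (M t)) (M t))ᵒᵈ) := inferInstance
  have h2 : WellFoundedGT (∀ t : T, Submodule (Module.End R (M t)) (M t)) :=
    ⟨h1.wf⟩
  exact isNoetherian_iff'.2 (componentEmbedding hT).wellFoundedGT

/-- The elements of `N` killed by all homomorphisms to the `P t` with `t ∉ F`. -/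
def rejectOutside {κ : Type*} (P : κ → Type*) [∀ t, AddCommGroup (P t)] [∀ t, Module R (P t)]
    (N : Type*) [AddCommGroup N] [Module R N]
    (F : Finset κ) : Submodule (Module.End R N) N where
  carrier := {n | ∀ s ∉ F, ∀ f : N →ₗ[R] P s, f n = 0}
  add_mem' ha hb s hs f := by rw [map_add, ha s hs, hb s hs, add_zero]
  zero_mem' s _ f := map_zero f
  smul_mem' h _ hn s hs f := hn s hs (f ∘ₗ h)

/-- The endosubmodule of `N` generated by the images of the `P t` with `t ∉ F`. -/
def traceOutside {κ : Type*} (P : κ → Type*) [∀ t, AddCommGroup (P t)] [∀ t, Module R (P t)]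
    (N : Type*) [AddCommGroup N] [Module R N]
    (F : Finset κ) : Submodule (Module.End R N) N :=
  Submodule.span _ {n | ∃ s ∉ F, ∃ f : P s →ₗ[R] N, n ∈ LinearMap.range f}

theorem finite_of_isEndoNoetherian {T : Set ι} (hT : IsTransversal R M T)
    (hM : ∀ i, Nontrivial (M i)) (h : IsEndoNoetherian R (⨁ i, M i))
    (hnil : IsRightSemiTNilpotent R (fun t : T => M t)) : T.Finite := by
  classical
  by_contra hinf
  have : Infinite T := Set.infinite_coe_iff.2 hinf
  have : WellFoundedGT (Submodule (Module.End R (⨁ i, M i)) (⨁ i, M i)) := isNoetherian_iff'.1 h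
  let K : Finset T → Submodule (Module.End R (⨁ i, M i)) (⨁ i, M i) :=
    rejectOutside (fun t : T => M t) (⨁ i, M i)
  have hK : ∀ F G, F ⊆ G → K F ≤ K G := fun F G hFG n hn s hs f => hn s (fun h => hs (hFG h)) f
  obtain ⟨_, ⟨F₀, rfl⟩, hF₀⟩ := wellFounded_gt.has_min (Set.range K) ⟨_, ⟨∅, rfl⟩⟩
  have hstab : ∀ F, F₀ ⊆ F → K F = K F₀ := fun F hF =>
    ((hK _ _ hF).eq_of_not_lt (hF₀ _ ⟨F, rfl⟩)).symm
  have step : ∀ (F : Finset T) (_ : F₀ ⊆ F) (t : T) (_ : t ∉ F) (x : M t) (_ : x ≠ 0),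
      ∃ s ∉ insert t F, ∃ f : M t →ₗ[R] M s, f x ≠ 0 := by
    intro F hF t ht x hx
    by_contra! hcon
    -- By stability `x` would lie in `K F₀`, but the projection to `M t` with `t ∉ F₀` does not kill
    -- it.
    have hmem : DirectSum.lof R ι M t x ∈ K (insert t F) := fun s hs f =>
      hcon s hs (f ∘ₗ DirectSum.lof R ι M t)
    rw [hstab _ (hF.trans (Finset.subset_insert _ _))] at hmem
    have h0 := hmem t (fun h => ht (hF h)) (DirectSum.component R ι M t)
    rw [DirectSum.component.lof_self] at h0
    exact hx h0
  -- A state consists of the indices already excluded, the current index and a nonzero element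
  -- there.
  let σ := {a : Σ (_ : Finset T) (t : T), M t // F₀ ⊆ a.1 ∧ a.2.1 ∉ a.1 ∧ a.2.2 ≠ 0}
  obtain ⟨t₀, ht₀⟩ := Infinite.exists_notMem_finset F₀
  obtain ⟨x₀, hx₀⟩ := exists_ne (0 : M t₀)
  obtain ⟨q, -, hq, hnot⟩ := exists_not_rightNilpotentAlong (R := R) (M := fun t : T => M t)
    (σ := σ) (fun a => a.1.2.1) (fun a => a.1.2.2) (fun a => a.2.2.2)
    (r := fun a b => b.1.1 = insert a.1.2.1 a.1.1) (by
      rintro ⟨⟨F, t, x⟩, hF, ht, hx⟩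
      obtain ⟨s, hs, f, hf⟩ := step F hF t ht x hx
      refine ⟨⟨⟨insert t F, s, f x⟩, hF.trans (Finset.subset_insert _ _), hs, hf⟩, rfl, f,
        fun hb => hs ?_, rfl⟩
      rw [← hT.eq_of_bijective f hb]
      exact Finset.mem_insert_self _ _) ⟨⟨F₀, t₀, x₀⟩, subset_rfl, ht₀, hx₀⟩
  refine hnot (hnil _ (injective_of_recorded _ (fun n => ((q n).1.1 : Set T)) (fun n => (q n).2.2.1)
    (fun n => ?_) (fun n => ?_)))
  · simp only [hq n, Finset.coe_insert, Set.subset_insert]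
  · simp only [hq n, Finset.coe_insert, Set.mem_insert_iff, true_or]

theorem finite_of_isEndoArtinian {T : Set ι} (hT : IsTransversal R M T)
    (hM : ∀ i, Nontrivial (M i)) (h : IsEndoArtinian R (⨁ i, M i))
    (hnil : IsLeftSemiTNilpotent R (fun t : T => M t)) : T.Finite := by
  classical
  by_contra hinf
  have : Infinite T := Set.infinite_coe_iff.2 hinf
  have : WellFoundedLT (Submodule (Module.End R (⨁ i, M i)) (⨁ i, M i)) := h
  let K : Finset T → Submodule (Module.End R (⨁ i, M i)) (⨁ i, M i) :=
    traceOutside (fun t : T => M t) (⨁ i, M i)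
  have hK : ∀ F G, F ⊆ G → K G ≤ K F := fun F G hFG => Submodule.span_mono
    fun n ⟨s, hs, f, hf⟩ => ⟨s, fun h => hs (hFG h), f, hf⟩
  obtain ⟨_, ⟨F₀, rfl⟩, hF₀⟩ := wellFounded_lt.has_min (Set.range K) ⟨_, ⟨∅, rfl⟩⟩
  have hstab : ∀ F, F₀ ⊆ F → K F = K F₀ := fun F hF =>
    (hK _ _ hF).eq_of_not_lt (hF₀ _ ⟨F, rfl⟩)
  have step : ∀ (F : Finset T) (_ : F₀ ⊆ F) (t : T) (_ : t ∉ F) (X : Submodule R (M t))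
      (_ : X ≠ ⊤), ∃ s ∉ insert t F, ∃ f : M s →ₗ[R] M t, X.comap f ≠ ⊤ := by
    intro F hF t ht X hX
    by_contra! hcon
    apply hX
    rw [eq_top_iff]
    intro x _
    have hmem : DirectSum.lof R ι M t x ∈ K F₀ :=
      Submodule.subset_span ⟨t, fun h => ht (hF h), _, x, rfl⟩
    rw [← hstab _ (hF.trans (Finset.subset_insert t F))] at hmem
    -- If all maps from outside `insert t F` land in `X`, so does the whole trace; stability puts
    -- all of `M t` into that trace.
    have key : ∀ n ∈ K (insert t F), ∀ f : (⨁ i, M i) →ₗ[R] M t, f n ∈ X := by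
      intro n hn
      induction hn using Submodule.span_induction with
      | mem n hn =>
        obtain ⟨s, hs, g, y, rfl⟩ := hn
        intro f
        have : y ∈ X.comap (f ∘ₗ g) := by rw [hcon s hs]; trivial
        exact this
      | zero => intro f; simp
      | add a b _ _ ha hb => intro f; rw [map_add]; exact X.add_mem (ha f) (hb f)
      | smul e a _ ha => exact fun f => ha (f ∘ₗ e)
    simpa [DirectSum.component.lof_self] using key _ hmem (DirectSum.component R ι M t)
  let σ := {a : Σ (_ : Finset T) (t : T), Submodule R (M t) //
    F₀ ⊆ a.1 ∧ a.2.1 ∉ a.1 ∧ a.2.2 ≠ ⊤}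
  obtain ⟨t₀, ht₀⟩ := Infinite.exists_notMem_finset F₀
  obtain ⟨x₀, hx₀⟩ := exists_ne (0 : M t₀)
  obtain ⟨X₀, hxX, hX₀⟩ := exists_isFinitelyCogenerated_quotient (R := R) hx₀
  have hX₀' : X₀ ≠ ⊤ := fun h => hxX (by rw [h]; trivial)
  obtain ⟨q, -, hq, hnot⟩ := exists_not_leftNilpotentAlong (R := R) (M := fun t : T => M t)
    (σ := σ) (fun a => a.1.2.1) (fun a => a.1.2.2) (fun a => a.2.2.2)
    (r := fun a b => b.1.1 = insert a.1.2.1 a.1.1) (by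
      rintro ⟨⟨F, t, X⟩, hF, ht, hX⟩
      obtain ⟨s, hs, f, hf⟩ := step F hF t ht X hX
      refine ⟨⟨⟨insert t F, s, X.comap f⟩, hF.trans (Finset.subset_insert _ _), hs, hf⟩, rfl, f,
        fun hb => hs ?_, rfl⟩
      rw [hT.eq_of_bijective f hb]
      exact Finset.mem_insert_self _ _)
    ⟨⟨F₀, t₀, X₀⟩, subset_rfl, ht₀, hX₀'⟩ hX₀
  refine hnot (hnil _ (injective_of_recorded _ (fun n => ((q n).1.1 : Set T)) (fun n => (q n).2.2.1)
    (fun n => ?_) (fun n => ?_)))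
  · simp only [hq n, Finset.coe_insert, Set.subset_insert]
  · simp only [hq n, Finset.coe_insert, Set.mem_insert_iff, true_or]

end Endo


/-! ### Killed submodules and the endosocle -/

section Killed

variable {R : Type u} [Ring R] {ι : Type v} (M : ι → Type w) [∀ i, AddCommGroup (M i)]
  [∀ i, Module R (M i)]

variable (R) in
/-- The elements of `M s` killed by all non-isomorphisms to the `M t` with `t ∈ A`. -/
def killed (A : Set ι) (s : ι) : Submodule R (M s) where
  carrier := {y | ∀ t ∈ A, ∀ g : M s →ₗ[R] M t, ¬ Function.Bijective g → g y = 0}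
  add_mem' ha hb t ht g hg := by rw [map_add, ha t ht g hg, hb t ht g hg, add_zero]
  zero_mem' t _ g _ := map_zero g
  smul_mem' r y hy t ht g hg := by rw [map_smul, hy t ht g hg, smul_zero]

variable {M}

theorem map_mem_killed {A : Set ι} {s : ι} {y : M s} (hy : y ∈ killed R M A s)
    (e : M s →ₗ[R] M s) (hs : s ∈ A) : e y ∈ killed R M A s := by
  intro t ht g hg
  by_cases he : Function.Bijective e
  · exact hy t ht (g ∘ₗ e) fun h => hg ((Function.Bijective.of_comp_iff g he).1 h)
  · rw [hy s hs e he, map_zero]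

/-- Under right T-nilpotence, every nonzero element can be moved to a nonzero killed element. -/
theorem exists_map_mem_killed (hnil : IsRightTNilpotent R M) (A : Set ι) {t : ι} (ht : t ∈ A)
    {x : M t} (hx : x ≠ 0) :
    ∃ s ∈ A, ∃ f : M t →ₗ[R] M s, f x ≠ 0 ∧ f x ∈ killed R M A s := by
  by_contra! hcon
  -- The composite from `M t` is kept as the state. Indices may recur here, so full T-nilpotence is
  -- needed.
  let σ := {a : Σ s : ι, M t →ₗ[R] M s // a.1 ∈ A ∧ a.2 x ≠ 0}
  obtain ⟨q, -, -, hq⟩ := exists_not_rightNilpotentAlong (R := R) (M := M) (σ := σ)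
    (fun a => a.1.1) (fun a => a.1.2 x) (fun a => a.2.2) (r := fun _ _ => True) (by
      rintro ⟨⟨s, f⟩, hs, hf⟩
      have := hcon s hs f hf
      change ¬ ∀ t ∈ A, ∀ g : M s →ₗ[R] M t, ¬ Function.Bijective g → g (f x) = 0 at this
      push Not at this
      obtain ⟨s', hs', g, hg, hgf⟩ := this
      exact ⟨⟨⟨s', g ∘ₗ f⟩, hs', hgf⟩, trivial, g, hg, rfl⟩) ⟨⟨t, LinearMap.id⟩, ht, hx⟩
  exact hq (hnil _)

/-- The endosubmodule of a direct sum given by a family of submodules of the summands that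
are closed under endomorphisms and lie in the killed submodules. -/
def familySubmodule (hM : ∀ s t (f : M s →ₗ[R] M t), Function.Bijective f → s = t)
    (L : ∀ s, Submodule R (M s)) (hL : ∀ s, L s ≤ killed R M Set.univ s)
    (hend : ∀ s (e : M s →ₗ[R] M s), ∀ x ∈ L s, e x ∈ L s) :
    Submodule (Module.End R (⨁ i, M i)) (⨁ i, M i) where
  carrier := {n | ∀ s, n s ∈ L s}
  add_mem' ha hb s := (L s).add_mem (ha s) (hb s)
  zero_mem' s := (L s).zero_mem
  smul_mem' h n hn t := by
    classical
    change DirectSum.component R ι M t (h n) ∈ L t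
    rw [← DirectSum.sum_support_of n, map_sum, map_sum]
    refine (L t).sum_mem fun s _ => ?_
    by_cases hst : s = t
    · subst hst
      exact hend s (DirectSum.component R ι M s ∘ₗ h ∘ₗ DirectSum.lof R ι M s) _ (hn s)
    · have := hL s (hn s) t trivial
        (DirectSum.component R ι M t ∘ₗ h ∘ₗ DirectSum.lof R ι M s) fun hb => hst (hM _ _ _ hb)
      change DirectSum.component R ι M t (h (DirectSum.lof R ι M s (n s))) = 0 at this
      change DirectSum.component R ι M t (h (DirectSum.lof R ι M s (n s))) ∈ L t
      rw [this]
      exact (L t).zero_mem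

theorem end_apply_lof [DecidableEq ι]
    (hM : ∀ s t (f : M s →ₗ[R] M t), Function.Bijective f → s = t)
    {s : ι} {y : M s} (hy : y ∈ killed R M Set.univ s) (h : Module.End R (⨁ i, M i)) :
    h (DirectSum.lof R ι M s y) = DirectSum.lof R ι M s
      ((DirectSum.component R ι M s ∘ₗ h ∘ₗ DirectSum.lof R ι M s) y) := by
  refine DirectSum.ext_component R fun t => ?_
  by_cases hst : s = t
  · subst hst
    rw [DirectSum.component.lof_self]
    rfl
  · rw [DirectSum.component.of, dif_neg hst]
    exact hy t trivial (DirectSum.component R ι M t ∘ₗ h ∘ₗ DirectSum.lof R ι M s)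
      fun hb => hst (hM _ _ _ hb)

/-- An endomorphism of the sum acts on `y` through an endomorphism `e` of `M s`, which kills `y` or
is invertible; in the latter case `e⁻¹` recovers `y` from its image. -/
theorem isSimpleModule_span_lof [DecidableEq ι]
    (hM : ∀ s t (f : M s →ₗ[R] M t), Function.Bijective f → s = t)
    {s : ι} {y : M s} (hy : y ∈ killed R M Set.univ s) (hy0 : y ≠ 0) :
    IsSimpleModule (Module.End R (⨁ i, M i))
      (Submodule.span (Module.End R (⨁ i, M i)) {DirectSum.lof R ι M s y}) := by
  rw [isSimpleModule_iff_isAtom]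
  have hinj : DirectSum.lof R ι M s y ≠ 0 := fun h0 => hy0 <| by
    rw [← DirectSum.component.lof_self (R := R) s y, h0, map_zero]
  refine ⟨by simpa using hinj, fun V hV => ?_⟩
  by_contra hV0
  refine hV.not_ge ?_
  obtain ⟨v, hv, hv0⟩ := V.exists_mem_ne_zero_of_ne_bot hV0
  obtain ⟨h, rfl⟩ := Submodule.mem_span_singleton.1 (hV.le hv)
  change h (DirectSum.lof R ι M s y) ∈ V at hv
  change h (DirectSum.lof R ι M s y) ≠ 0 at hv0
  rw [end_apply_lof hM hy] at hv hv0
  set e := DirectSum.component R ι M s ∘ₗ h ∘ₗ DirectSum.lof R ι M s with he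
  have hb : Function.Bijective e := by
    by_contra hb
    exact hv0 (by rw [hy s trivial e hb, map_zero])
  rw [Submodule.span_singleton_le_iff_mem]
  have := V.smul_mem (DirectSum.lof R ι M s ∘ₗ (LinearEquiv.ofBijective e hb).symm.toLinearMap ∘ₗ
    DirectSum.component R ι M s) hv
  change DirectSum.lof R ι M s ((LinearEquiv.ofBijective e hb).symm
    (DirectSum.component R ι M s (DirectSum.lof R ι M s (e y)))) ∈ V at this
  rw [DirectSum.component.lof_self] at this
  have h2 : (LinearEquiv.ofBijective e hb).symm (e y) = y :=
    (LinearEquiv.ofBijective e hb).symm_apply_apply y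
  rwa [h2] at this

theorem familySubmodule_le_endosocle
    (hM : ∀ s t (f : M s →ₗ[R] M t), Function.Bijective f → s = t)
    (L : ∀ s, Submodule R (M s)) (hL : ∀ s, L s ≤ killed R M Set.univ s)
    (hend : ∀ s (e : M s →ₗ[R] M s), ∀ x ∈ L s, e x ∈ L s) :
    familySubmodule hM L hL hend ≤ endosocle R (⨁ i, M i) := by
  classical
  intro n hn
  rw [← DirectSum.sum_support_of n]
  refine Submodule.sum_mem _ fun s _ => ?_
  by_cases h0 : n s = 0
  · rw [h0, map_zero]
    exact Submodule.zero_mem _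
  · exact Submodule.mem_sSup_of_mem (isSimpleModule_span_lof hM (hL s (hn s)) h0)
      (Submodule.mem_span_singleton_self _)

theorem isSemisimpleModule_socle (S : Type*) [Ring S] (N : Type*) [AddCommGroup N] [Module S N] :
    IsSemisimpleModule S (socle S N) := by
  rw [socle, sSup_eq_iSup]
  exact isSemisimpleModule_biSup_of_isSemisimpleModule_submodule (p := id) fun U hU =>
    have : IsSimpleModule S U := hU
    inferInstanceAs (IsSemisimpleModule S U)

theorem lof_mem_familySubmodule_iff [DecidableEq ι]
    (hM : ∀ s t (f : M s →ₗ[R] M t), Function.Bijective f → s = t)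
    (L : ∀ s, Submodule R (M s)) (hL : ∀ s, L s ≤ killed R M Set.univ s)
    (hend : ∀ s (e : M s →ₗ[R] M s), ∀ x ∈ L s, e x ∈ L s) {s : ι} {y : M s} :
    DirectSum.lof R ι M s y ∈ familySubmodule hM L hL hend ↔ y ∈ L s := by
  refine ⟨fun h => ?_, fun h t => ?_⟩
  · have := h s
    rwa [DirectSum.lof_apply] at this
  · change DirectSum.component R ι M t (DirectSum.lof R ι M s y) ∈ L t
    rw [DirectSum.component.of]
    split_ifs with hst
    · subst hst
      exact h
    · exact (L t).zero_mem

/-- The killed parts form an endosubmodule of a noetherian endosocle, so they are confined to the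
finite support of a finite generating set. -/
theorem finite_killed_ne_bot (hM : ∀ s t (f : M s →ₗ[R] M t), Function.Bijective f → s = t)
    (hfg : (endosocle R (⨁ i, M i)).FG) : {s | killed R M Set.univ s ≠ ⊥}.Finite := by
  classical
  have hsemi := isSemisimpleModule_socle (Module.End R (⨁ i, M i)) (⨁ i, M i)
  have hfin : Module.Finite (Module.End R (⨁ i, M i)) (endosocle R (⨁ i, M i)) :=
    Module.Finite.iff_fg.2 hfg
  have hnoeth : IsNoetherian (Module.End R (⨁ i, M i)) (endosocle R (⨁ i, M i)) :=
    @IsSemisimpleModule.instIsNoetherianOfFinite _ _ _ _ _ hsemi hfin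
  have hend : ∀ s (e : M s →ₗ[R] M s), ∀ x ∈ killed R M Set.univ s,
      e x ∈ killed R M Set.univ s := fun s e x hx => map_mem_killed hx e trivial
  obtain ⟨X, hX⟩ := isNoetherian_submodule.1 hnoeth _
    (familySubmodule_le_endosocle hM (killed R M Set.univ) (fun _ => le_rfl) hend)
  let B : Finset ι := X.biUnion fun n => DFinsupp.support n
  refine B.finite_toSet.subset fun s hs => ?_
  by_contra hsB
  obtain ⟨y, hy, hy0⟩ := Submodule.exists_mem_ne_zero_of_ne_bot hs
  -- Truncation to `B` still gives an endosubmodule containing all generators, so `y` outside `B`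
  -- must vanish.
  let L : ∀ s, Submodule R (M s) := fun s => if s ∈ B then killed R M Set.univ s else ⊥
  have hL : ∀ s, L s ≤ killed R M Set.univ s := by
    intro s
    simp only [L]
    split_ifs
    exacts [le_rfl, bot_le]
  have hLend : ∀ s (e : M s →ₗ[R] M s), ∀ x ∈ L s, e x ∈ L s := by
    intro s e x
    simp only [L]
    split_ifs
    · exact hend s e x
    · simp +contextual
  have hle : familySubmodule hM (killed R M Set.univ) (fun _ => le_rfl) hend ≤
      familySubmodule hM L hL hLend := by
    rw [← hX, Submodule.span_le]
    intro n hn t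
    have hnt : n ∈ familySubmodule hM (killed R M Set.univ) (fun _ => le_rfl) hend :=
      hX ▸ Submodule.subset_span hn
    by_cases htB : t ∈ B
    · simp only [L, if_pos htB]
      exact hnt t
    · simp only [L, if_neg htB, Submodule.mem_bot]
      by_contra hne
      exact htB (Finset.mem_biUnion.2 ⟨n, hn, DFinsupp.mem_support_toFun _ _ |>.2 hne⟩)
  have := hle ((lof_mem_familySubmodule_iff hM _ _ _).2 hy)
  rw [lof_mem_familySubmodule_iff] at this
  simp only [L, if_neg (fun h => hsB (Finset.mem_coe.2 h)), Submodule.mem_bot] at this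
  exact hy0 this

/-- A finitely generated semisimple module is artinian, and the families `L d` embed as a descending
chain in the endosocle. -/
theorem stabilizes_of_endosocle_fg
    (hM : ∀ s t (f : M s →ₗ[R] M t), Function.Bijective f → s = t)
    (hfg : (endosocle R (⨁ i, M i)).FG) (L : ℕ → ∀ s, Submodule R (M s))
    (hL : ∀ d s, L d s ≤ killed R M Set.univ s)
    (hend : ∀ d s (e : M s →ₗ[R] M s), ∀ x ∈ L d s, e x ∈ L d s) (hanti : Antitone L) :
    ∃ d, ∀ d' ≥ d, L d' = L d := by
  classical
  have hsemi := isSemisimpleModule_socle (Module.End R (⨁ i, M i)) (⨁ i, M i)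
  have hfin : Module.Finite (Module.End R (⨁ i, M i)) (endosocle R (⨁ i, M i)) :=
    Module.Finite.iff_fg.2 hfg
  have hart : IsArtinian (Module.End R (⨁ i, M i)) (endosocle R (⨁ i, M i)) :=
    (@IsSemisimpleModule.finite_tfae _ _ _ _ _ hsemi |>.out 0 2).1 hfin
  let K : ℕ → Submodule (Module.End R (⨁ i, M i)) (⨁ i, M i) := fun d =>
    familySubmodule hM (L d) (hL d) (hend d)
  have hK : Antitone K := fun d d' h n hn s => hanti h s (hn s)
  let K' : ℕ →o (Submodule (Module.End R (⨁ i, M i)) (endosocle R (⨁ i, M i)))ᵒᵈ :=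
    ⟨fun d => OrderDual.toDual ((K d).comap (endosocle R (⨁ i, M i)).subtype),
      fun d d' h => Submodule.comap_mono (hK h)⟩
  obtain ⟨d, hd⟩ := IsArtinian.monotone_stabilizes K'
  refine ⟨d, fun d' hdd' => le_antisymm (hanti hdd') fun s y hy => ?_⟩
  have h1 : DirectSum.lof R ι M s y ∈ K d := (lof_mem_familySubmodule_iff hM _ _ _).2 hy
  have h2 : (⟨_, familySubmodule_le_endosocle hM _ _ _ h1⟩ : endosocle R (⨁ i, M i)) ∈
      (K d').comap (endosocle R (⨁ i, M i)).subtype := by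
    have := congrArg OrderDual.ofDual (hd d' hdd')
    change (K d).comap (endosocle R (⨁ i, M i)).subtype =
      (K d').comap (endosocle R (⨁ i, M i)).subtype at this
    rw [← this]
    exact h1
  exact (lof_mem_familySubmodule_iff hM _ (hL d') (hend d')).1 h2

theorem killed_subtype (A : Set ι) (s : A) :
    killed R (fun t : A => M t) Set.univ s = killed R M A s := by
  ext y
  exact ⟨fun h t ht g hg => h ⟨t, ht⟩ trivial g hg, fun h t _ g hg => h t t.2 g hg⟩

end Killed


/-! ### Layers of indices and paths between them: part (III) -/

section Layers

variable {R : Type u} [Ring R] {ι : Type v} (M : ι → Type w) [∀ i, AddCommGroup (M i)]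
  [∀ i, Module R (M i)]

variable (R) in
/-- The sets of indices obtained from the whole index set by repeatedly removing the indices at
which the killed submodules are nonzero. -/
def layerSet : ℕ → Set ι
  | 0 => Set.univ
  | n + 1 => layerSet n \ {s | killed R M (layerSet n) s ≠ ⊥}

variable (R) in
/-- The submodule of the `n`-th killed submodule generated by the ends of paths that start in the
`(n + d)`-th killed submodules and pass through all the killed submodules in between. -/
def pathEnds : ℕ → ℕ → ∀ s, Submodule R (M s)
  | 0, n, s => killed R M (layerSet R M n) s
  | d + 1, n, s => Submodule.span R {y | y ∈ killed R M (layerSet R M n) s ∧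
      ∃ t ∈ layerSet R M (n + 1), ∃ f : M t →ₗ[R] M s, ∃ z ∈ pathEnds d (n + 1) t, f z = y}

variable {M}

theorem layerSet_antitone : Antitone (layerSet R M) :=
  antitone_nat_of_succ_le fun _ => Set.sdiff_subset

theorem pathEnds_succ_le (d n : ℕ) (s : ι) : pathEnds R M (d + 1) n s ≤ pathEnds R M d n s := by
  induction d generalizing n s with
  | zero => exact Submodule.span_le.2 fun y hy => hy.1
  | succ d ih =>
    exact Submodule.span_mono fun y ⟨hy, t, ht, f, z, hz, hfz⟩ => ⟨hy, t, ht, f, z, ih _ _ hz, hfz⟩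

theorem pathEnds_antitone (n : ℕ) (s : ι) : Antitone fun d => pathEnds R M d n s :=
  antitone_nat_of_succ_le fun d => pathEnds_succ_le d n s

theorem pathEnds_le_killed (d n : ℕ) (s : ι) :
    pathEnds R M d n s ≤ killed R M (layerSet R M n) s :=
  pathEnds_antitone n s (Nat.zero_le d)

theorem map_mem_pathEnds (d n : ℕ) {s : ι} (hs : s ∈ layerSet R M n) (e : M s →ₗ[R] M s)
    {x : M s} (hx : x ∈ pathEnds R M d n s) : e x ∈ pathEnds R M d n s := by
  cases d with
  | zero => exact map_mem_killed hx e hs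
  | succ d =>
    have : pathEnds R M (d + 1) n s ≤ (pathEnds R M (d + 1) n s).comap e :=
      Submodule.span_le.2 fun y ⟨hy, t, ht, f, z, hz, hfz⟩ => Submodule.subset_span
        ⟨map_mem_killed hy e hs, t, ht, e ∘ₗ f, z, hz, congrArg e hfz⟩
    exact this hx

/-- A path is built from its deep end: a nonzero element found in layer `n + 1` is moved within
layer `n` to a killed one. -/
theorem exists_pathEnds_ne_bot (hM : ∀ i, Nontrivial (M i)) (hright : IsRightTNilpotent R M)
    (hne : ∀ n, (layerSet R M n).Nonempty) (d n : ℕ) :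
    ∃ s ∈ layerSet R M n, pathEnds R M d n s ≠ ⊥ := by
  induction d generalizing n with
  | zero =>
    obtain ⟨t, ht⟩ := hne n
    obtain ⟨x, hx⟩ := exists_ne (0 : M t)
    obtain ⟨s, hs, f, hf, hfk⟩ := exists_map_mem_killed hright _ ht hx
    exact ⟨s, hs, fun h => hf ((Submodule.eq_bot_iff _).1 h _ hfk)⟩
  | succ d ih =>
    obtain ⟨t, ht, hbot⟩ := ih (n + 1)
    obtain ⟨x, hxm, hx⟩ := Submodule.exists_mem_ne_zero_of_ne_bot hbot
    obtain ⟨s, hs, f, hf, hfk⟩ :=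
      exists_map_mem_killed hright _ (layerSet_antitone (Nat.le_succ n) ht) hx
    exact ⟨s, hs, fun h => hf ((Submodule.eq_bot_iff _).1 h _
      (Submodule.subset_span ⟨hfk, t, ht, f, x, hxm, rfl⟩))⟩

theorem layerSet_compl_finite (hinj : ∀ s t (f : M s →ₗ[R] M t), Function.Bijective f → s = t)
    (hfg : ∀ A : Set ι, Aᶜ.Finite → (endosocle R (⨁ t : A, M t)).FG) (n : ℕ) :
    (layerSet R M n)ᶜ.Finite := by
  induction n with
  | zero => simp [layerSet]
  | succ n ih =>
    have h := finite_killed_ne_bot (R := R) (M := fun t : layerSet R M n => M t)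
      (fun s t f hf => Subtype.ext (hinj _ _ f hf)) (hfg _ ih)
    refine (ih.union (h.image Subtype.val)).subset fun s hs => ?_
    by_cases hsn : s ∈ layerSet R M n
    · refine Or.inr ⟨⟨s, hsn⟩, ?_, rfl⟩
      change killed R (fun t : layerSet R M n => M t) Set.univ ⟨s, hsn⟩ ≠ ⊥
      rw [killed_subtype]
      by_contra hk
      exact hs ⟨hsn, fun h => h hk⟩
    · exact Or.inl hsn

theorem exists_pathEnds_stable (hinj : ∀ s t (f : M s →ₗ[R] M t), Function.Bijective f → s = t)
    (hfg : ∀ A : Set ι, Aᶜ.Finite → (endosocle R (⨁ t : A, M t)).FG) (n : ℕ) :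
    ∃ d, ∀ d' ≥ d, ∀ s ∈ layerSet R M n, pathEnds R M d' n s = pathEnds R M d n s := by
  obtain ⟨d, hd⟩ := stabilizes_of_endosocle_fg (R := R) (M := fun t : layerSet R M n => M t)
    (fun s t f hf => Subtype.ext (hinj _ _ f hf)) (hfg _ (layerSet_compl_finite hinj hfg n))
    (fun d s => pathEnds R M d n s)
    (fun d s => by rw [killed_subtype]; exact pathEnds_le_killed (M := M) d n s)
    (fun d s e x hx => map_mem_pathEnds (M := M) d n s.2 e hx)
    (fun d d' h s => pathEnds_antitone (R := R) (M := M) n s h)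
  exact ⟨d, fun d' h s hs => congrFun (hd d' h) ⟨s, hs⟩⟩

theorem finite_of_endosocle_fg (hM : ∀ i, Nontrivial (M i))
    (hinj : ∀ s t (f : M s →ₗ[R] M t), Function.Bijective f → s = t)
    (hleft : IsLeftSemiTNilpotent R M) (hright : IsRightTNilpotent R M)
    (hfg : ∀ A : Set ι, Aᶜ.Finite → (endosocle R (⨁ t : A, M t)).FG) : Finite ι := by
  by_contra hinf
  rw [not_finite_iff_infinite] at hinf
  have hne : ∀ n, (layerSet R M n).Nonempty := fun n => by
    simpa using (layerSet_compl_finite hinj hfg n).infinite_compl.nonempty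
  have hstab : ∀ n, ∃ d, ∀ s ∈ layerSet R M n,
      pathEnds R M d n s = ⨅ d, pathEnds R M d n s := fun n => by
    obtain ⟨d, hd⟩ := exists_pathEnds_stable hinj hfg n
    refine ⟨d, fun s hs => le_antisymm (le_iInf fun d' => ?_) (iInf_le _ d)⟩
    rw [← hd (max d d') (le_max_left _ _) s hs]
    exact pathEnds_antitone n s (le_max_right _ _)
  -- A state is a layer, an index in it and a submodule not containing the stable part there.
  let σ := {a : Σ (_ : ℕ) (s : ι), Submodule R (M s) //
    a.2.1 ∈ layerSet R M a.1 ∧ ¬ (⨅ d, pathEnds R M d a.1 a.2.1) ≤ a.2.2}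
  have hnext : ∀ a : σ, a.1.2.1 ∉ layerSet R M (a.1.1 + 1) := fun a ha => ha.2 fun hk =>
    a.2.2 ((iInf_le _ 0).trans (hk.le.trans bot_le))
  obtain ⟨d₀, hd₀⟩ := hstab 0
  obtain ⟨s₀, hs₀, hbot⟩ := exists_pathEnds_ne_bot hM hright hne d₀ 0
  obtain ⟨w, hw, hw0⟩ := Submodule.exists_mem_ne_zero_of_ne_bot hbot
  rw [hd₀ s₀ hs₀] at hw
  obtain ⟨X₀, hwX, hX₀⟩ := exists_isFinitelyCogenerated_quotient (R := R) hw0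
  obtain ⟨q, -, hq, hnot⟩ := exists_not_leftNilpotentAlong (R := R) (M := M) (σ := σ)
    (fun a => a.1.2.1) (fun a => a.1.2.2) (fun a h => a.2.2 (h ▸ le_top))
    (r := fun a b => b.1.1 = a.1.1 + 1) (by
      intro a
      -- With `d` stable for the next layer, depth `d + 1` here is generated by images of stable
      -- elements of that layer; one such image avoids the submodule.
      obtain ⟨d, hd⟩ := hstab (a.1.1 + 1)
      have h1 : ¬ pathEnds R M (d + 1) a.1.1 a.1.2.1 ≤ a.1.2.2 := fun h =>
        a.2.2 ((iInf_le _ _).trans h)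
      have h2 : ∃ t ∈ layerSet R M (a.1.1 + 1), ∃ f : M t →ₗ[R] M a.1.2.1,
          ∃ z ∈ pathEnds R M d (a.1.1 + 1) t, f z ∉ a.1.2.2 := by
        by_contra! hcon
        refine h1 (Submodule.span_le.2 ?_)
        rintro y ⟨-, t, ht, f, z, hz, rfl⟩
        exact hcon t ht f z hz
      obtain ⟨t, ht, f, z, hz, hfz⟩ := h2
      rw [hd t ht] at hz
      refine ⟨⟨⟨a.1.1 + 1, t, a.1.2.2.comap f⟩, ht, fun h => hfz (h hz)⟩, rfl, f,
        fun hb => hnext a ?_, rfl⟩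
      rw [← hinj _ _ f hb]
      exact ht) ⟨⟨0, s₀, X₀⟩, hs₀, fun h => hwX (h hw)⟩ hX₀
  refine hnot (hleft _ (injective_of_recorded _ (fun n => (layerSet R M (q n).1.1)ᶜ)
    (fun n h => h (q n).2.1) (fun n => ?_) (fun n => ?_)))
  · rw [hq n]
    exact Set.compl_subset_compl.2 (layerSet_antitone (Nat.le_succ _))
  · rw [hq n]
    exact hnext (q n)

end Layers

end EndoSum

theorem theoremH {R : Type*} [Ring R] {I : Type*} (M : I → Type*)
    [∀ i, AddCommGroup (M i)] [∀ i, Module R (M i)]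
    (hM : ∀ i, EndoSum.IsIndecomposable R (M i))
    (T : Set I) (hT : EndoSum.IsTransversal R M T) :
    ((∀ i, IsLocalRing (Module.End R (M i))) →
      ((EndoSum.IsEndoNoetherian R (⨁ i, M i) ∧
          EndoSum.IsRightSemiTNilpotent R (fun t : T => M t)) ↔
        (T.Finite ∧ ∀ t : T, EndoSum.IsEndoNoetherian R (M t)))) ∧
    ((EndoSum.IsEndoArtinian R (⨁ i, M i) ∧
        EndoSum.IsLeftSemiTNilpotent R (fun t : T => M t)) ↔
      (T.Finite ∧ ∀ t : T, EndoSum.IsEndoArtinian R (M t))) ∧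
    (EndoSum.IsLeftSemiTNilpotent R (fun t : T => M t) →
      EndoSum.IsRightTNilpotent R (fun t : T => M t) →
      (∀ T' : Set T, T'ᶜ.Finite → (EndoSum.endosocle R (⨁ t : T', M t)).FG) →
      T.Finite) := by
  classical
  have hnt : ∀ i, Nontrivial (M i) := fun i => (hM i).1
  -- For finite `T` both semi-T-nilpotence conditions are vacuous.
  have hno : T.Finite → ∀ i : ℕ → T, ¬ Function.Injective i := fun hfin i => by
    have := hfin.to_subtype
    exact not_injective_infinite_finite i
  refine ⟨fun _ => ⟨fun ⟨h, hnil⟩ => ⟨EndoSum.finite_of_isEndoNoetherian hT hnt h hnil, fun t =>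
      h.of_retract (DirectSum.lof R I M t) (DirectSum.component R I M t)
        (DirectSum.component.lof_self (R := R) _)⟩,
      fun ⟨hfin, h⟩ => ⟨EndoSum.isEndoNoetherian_directSum hT hfin h,
        fun i hi => absurd hi (hno hfin i)⟩⟩,
    ⟨fun ⟨h, hnil⟩ => ⟨EndoSum.finite_of_isEndoArtinian hT hnt h hnil, fun t =>
      h.of_retract (DirectSum.lof R I M t) (DirectSum.component R I M t)
        (DirectSum.component.lof_self (R := R) _)⟩,
      fun ⟨hfin, h⟩ => ⟨EndoSum.isEndoArtinian_directSum hT hfin h,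
        fun i hi => absurd hi (hno hfin i)⟩⟩,
    fun hleft hright hfg => ?_⟩
  exact Set.finite_coe_iff.1 (EndoSum.finite_of_endosocle_fg (fun t => hnt t)
    (fun s t f hf => hT.eq_of_bijective f hf) hleft hright hfg)
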